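/- Let $\mathcal M$ be a family of probability distributions on $\mathbb R$ with finite means; write $\mu(P)$ for the mean of $P$ and $D(P,Q)\in[0,\infty]$ for the Kullback–Leibler divergence. An environment is a tuple $\nu=(P_1,\dots,P_K)$ with $P_i\in\mathcal M$; put $\mu^*=\max_i\mu(P_i)$ and call arm $k$ sub-optimal in $\nu$ if $\mu(P_k)<\mu^*$. An algorithm $\pi$ chooses in each round an arm, possibly at random, on the basis of the arms played and the rewards received so far; the reward is then drawn from the distribution of the chosen arm. Let $\mathbb P_{\nu\pi}$, $\mathbb E_{\nu\pi}$ be the resulting probability and expectation, and let $N_k(T)$ be the number of plays of arm $k$ in the first $T$ rounds. Put $$d_{\inf}(P,m,\mathcal M)=\inf\{D(P,Q): Q\in\mathcal M,\ \mu(Q)>m\}\in[0,\infty],\qquad \inf\emptyset=\infty .$$ Suppose that $\pi$ is consistent over $\mathcal M$: for every environment $\nu$ with distributions in $\mathcal M$, every arm $k$ that is sub-optimal in $\nu$ and every $a>0$, $\lim_{T\to\infty}\mathbb E_{\nu\pi}[N_k(T)]/T^a=0$. Then for every environment $\nu=(P_1,\dots,P_K)$ with $P_i\in\mathcal M$ and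 every sub-optimal arm $k$, with $d=d_{\inf}(P_k,\mu^*,\mathcal M)$, $1/0=\infty$ and $1/\infty=0$: 1. if $d>0$, then for every $\eta\in(0,1)$, $$\lim_{T\to\infty}\mathbb P_{\nu\pi}\Big(\frac{N_k(T)}{\log T}\ge\frac{1-\eta}{d}\Big)=1;$$ if $d=0$, then $\lim_{T\to\infty}\mathbb P_{\nu\pi}\big(N_k(T)/\log T\ge c\big)=1$ for every real $c$; 2. $$\liminf_{T\to\infty}\frac{\mathbb E_{\nu\pi}[N_k(T)]}{\log T}\ge\frac1{d}.$$ -/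

import Mathlib

open MeasureTheory ProbabilityTheory Filter Topology
open scoped ENNReal

namespace Bandit

/-- A (possibly randomized) bandit algorithm with `K` arms: the law of the first arm played, and,
for every `n`, the conditional law of the next arm given the arms played and the rewards received
in the first `n + 1` rounds (the rounds are indexed by `0, …, n`). -/
structure Policy (K : ℕ) where
  /-- law of the arm played in the first round -/
  init : Measure (Fin K)
  /-- law of the arm played in round `n + 1` given the rounds `0, …, n` -/
  next : (n : ℕ) → Kernel (Finset.Iic n → Fin K × ℝ) (Fin K)
  isProb_init : IsProbabilityMeasure init
  isMarkov_next : ∀ n, IsMarkovKernel (next n)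

attribute [instance] Policy.isProb_init Policy.isMarkov_next

/-- A bandit environment: one reward distribution for each of the `K` arms. -/
abbrev Env (K : ℕ) := Fin K → ProbabilityMeasure ℝ

variable {K : ℕ}

/-- The reward distribution of the arm that is played, as a Markov kernel. -/
noncomputable def Env.rewardKernel (ν : Env K) : Kernel (Fin K) ℝ where
  toFun k := (ν k : Measure ℝ)
  measurable' := measurable_of_finite _

instance (ν : Env K) : IsMarkovKernel ν.rewardKernel :=
  ⟨fun k => inferInstanceAs (IsProbabilityMeasure (ν k : Measure ℝ))⟩

/-- Law of (arm, reward) in the first round. -/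
noncomputable def firstLaw (ν : Env K) (π : Policy K) : Measure (Fin K × ℝ) :=
  π.init ⊗ₘ ν.rewardKernel

/-- Conditional law of (arm, reward) in round `n + 1` given the rounds `0, …, n`: the arm is drawn
by the algorithm, and, given the arm and the past, the reward is drawn from the distribution of
that arm. -/
noncomputable def stepKernel (ν : Env K) (π : Policy K) (n : ℕ) :
    Kernel (Finset.Iic n → Fin K × ℝ) (Fin K × ℝ) :=
  π.next n ⊗ₖ Kernel.prodMkLeft (Finset.Iic n → Fin K × ℝ) ν.rewardKernel

instance (ν : Env K) (π : Policy K) (n : ℕ) : IsMarkovKernel (stepKernel ν π n) := by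
  unfold stepKernel; infer_instance

/-- The law `ℙ_{νπ}` of the infinite sequence of (arm, reward) pairs generated by the algorithm `π`
interacting with the environment `ν`. -/
noncomputable def law (ν : Env K) (π : Policy K) : Measure (ℕ → Fin K × ℝ) :=
  Kernel.trajMeasure (X := fun _ => Fin K × ℝ) (firstLaw ν π) (stepKernel ν π)

/-- `N_k(T)`: the number of plays of arm `k` in the first `T` rounds. -/
def plays (k : Fin K) (T : ℕ) (ω : ℕ → Fin K × ℝ) : ℕ :=
  ((Finset.range T).filter fun t => (ω t).1 = k).card

/-- `𝔼_{νπ}[N_k(T)]`. -/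
noncomputable def expectedPlays (ν : Env K) (π : Policy K) (k : Fin K) (T : ℕ) : ℝ :=
  ∫ ω, (plays k T ω : ℝ) ∂(law ν π)

/-- The mean `μ(P)` of a distribution on the real line. -/
noncomputable def mean (P : ProbabilityMeasure ℝ) : ℝ := ∫ x, x ∂(P : Measure ℝ)

/-- The largest mean `μ* = max_k μ(P_k)` in the environment. -/
noncomputable def Env.bestMean (ν : Env K) : ℝ := ⨆ k, mean (ν k)

/-- Arm `k` is sub-optimal. -/
def Env.IsSuboptimal (ν : Env K) (k : Fin K) : Prop := mean (ν k) < ν.bestMean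

/-- `d_inf(P, m, 𝓜) = inf {D(P, Q) : Q ∈ 𝓜, μ(Q) > m}`, in `[0, ∞]`, with `inf ∅ = ∞`. -/
noncomputable def dInf (P : ProbabilityMeasure ℝ) (m : ℝ) (M : Set (ProbabilityMeasure ℝ)) :
    ℝ≥0∞ :=
  ⨅ Q ∈ {Q : ProbabilityMeasure ℝ | Q ∈ M ∧ m < mean Q},
    InformationTheory.klDiv (P : Measure ℝ) (Q : Measure ℝ)

/-- The algorithm `π` is consistent over the family `M`: in every environment with reward
distributions in `M`, the expected number of plays of every sub-optimal arm is `o(T ^ a)` for every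
`a > 0`. -/
def IsConsistent (π : Policy K) (M : Set (ProbabilityMeasure ℝ)) : Prop :=
  ∀ ν : Env K, (∀ i, ν i ∈ M) → ∀ k, ν.IsSuboptimal k → ∀ a : ℝ, 0 < a →
    Tendsto (fun T : ℕ => expectedPlays ν π k T / (T : ℝ) ^ a) atTop (𝓝 0)

end Bandit

/-!
The proof is the change-of-measure argument of Lai and Robbins, in a form that needs one moment of
the log-likelihood ratio only.

Let `d` be the value of `dInf` and let `c * d < 1`. Choose `Q` in the family with mean larger than
that of every arm of `ν` and `c * D < 1`, where `D = D(ν k, Q)`, and let `ν'` be `ν` with `Q` in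
place of `ν k`. In `ν'` arm `k` is the unique best arm, so a consistent algorithm plays the other
arms `o(T ^ a)` times in expectation for every `a > 0`. By Markov's inequality
(`law_plays_le_le`), the event `N_k(T) ≤ m` with `m ≈ c * log T` therefore has probability
`o(T ^ (a - 1))` under `ν'`.

On the events of the first `T` rounds the density of the law of `ν` with respect to that of `ν'` is
at most `exp L`, where `L` is the sum of the log-likelihood ratio `llr (ν k) Q` over the rewards
received from arm `k` (`lintegral_law_le_lintegral_law`). If `L ≤ m * (D + ε)`, passing from `ν'`
to `ν` costs a factor of order `T ^ (c * (D + ε))`, and for small `ε` this exponent is less than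
`1`, so it is `1 - a` for some `a > 0` and the event has vanishing probability under `ν`
(`law_le_exp_mul_law`).

The other case, `N_k(T) ≤ m` and `L > m * (D + ε)`, is excluded by a weak law of large numbers
under `ν` (`exists_law_rewardSum_gt_le`). The log-likelihood ratio is dominated by a bounded
function plus a nonnegative remainder of small mean. The sums are stopped after `m` plays of arm
`k`; the bounded part is then controlled by an exponential supermartingale and Hoeffding's lemma
(`lintegral_exp_stoppedRewardSum_le_one`), the remainder by Wald's identity and Markov's inequality
(`lintegral_stoppedRewardSum`). Both bounds are uniform in `T`, so that neither independent copies
of the rewards of an arm nor maximal inequalities are needed.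

Everything rests on a single description of one round of interaction (`lintegral_law_step`).
The bound in expectation follows from the one in probability by Markov's inequality.
-/

namespace Bandit

variable {K : ℕ}

/-! ### One round of interaction -/

instance (ν : Env K) (π : Policy K) : IsProbabilityMeasure (firstLaw ν π) := by
  unfold firstLaw; infer_instance

instance (ν : Env K) (π : Policy K) : IsProbabilityMeasure (law ν π) := by
  unfold law; infer_instance

/-- The conditional law of the arm played in round `n` given the past, as a kernel on whole
trajectories. This treats the first round (a constant kernel) and the later rounds uniformly. -/
noncomputable def Policy.armKernel (π : Policy K) : ℕ → Kernel (ℕ → Fin K × ℝ) (Fin K)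
  | 0 => Kernel.const _ π.init
  | n + 1 => (π.next n).comap (Preorder.frestrictLe n) (by fun_prop)

instance (π : Policy K) (n : ℕ) : IsMarkovKernel (π.armKernel n) := by
  cases n <;> unfold Policy.armKernel <;> infer_instance

lemma Policy.dependsOn_armKernel (π : Policy K) (n : ℕ) :
    DependsOn (fun ω => π.armKernel n ω) (Set.Iio n) := by
  intro x y h
  cases n with
  | zero => rfl
  | succ n =>
    simp only [Policy.armKernel, Kernel.comap_apply]
    congr 1
    funext i
    exact h i (Nat.lt_succ_of_le (Finset.mem_Iic.1 i.2))

lemma lintegral_law_first (ν : Env K) (π : Policy K) {F : Fin K × ℝ → ℝ≥0∞} (hF : Measurable F) :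
    ∫⁻ ω, F (ω 0) ∂(law ν π) = ∫⁻ y, F y ∂(firstLaw ν π) := by
  have h : (law ν π).map (fun ω => ω 0) = firstLaw ν π := by
    have h1 : (law ν π).map (Preorder.frestrictLe 0) =
        (firstLaw ν π).map (MeasurableEquiv.piUnique (fun _ : Finset.Iic 0 => Fin K × ℝ)).symm := by
      unfold law Kernel.trajMeasure
      rw [Measure.map_comp _ _ (by fun_prop), Kernel.traj_map_frestrictLe,
        Kernel.partialTraj_self, Measure.id_comp]
    have h2 : (fun ω : ℕ → Fin K × ℝ => ω 0) =
        (MeasurableEquiv.piUnique (fun _ : Finset.Iic 0 => Fin K × ℝ)) ∘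
          Preorder.frestrictLe 0 := rfl
    rw [h2, ← Measure.map_map (by fun_prop) (by fun_prop), h1,
      Measure.map_map (by fun_prop) (by fun_prop), MeasurableEquiv.self_comp_symm, Measure.map_id]
  rw [← h, lintegral_map hF (by fun_prop)]

lemma lintegral_law_succ (ν : Env K) (π : Policy K) (n : ℕ)
    {F : (Finset.Iic n → Fin K × ℝ) × (Fin K × ℝ) → ℝ≥0∞} (hF : Measurable F) :
    ∫⁻ ω, F (Preorder.frestrictLe n ω, ω (n + 1)) ∂(law ν π) =
      ∫⁻ ω, ∫⁻ y, F (Preorder.frestrictLe n ω, y)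
        ∂(stepKernel ν π n (Preorder.frestrictLe n ω)) ∂(law ν π) := by
  have h := Kernel.map_frestrictLe_trajMeasure_compProd_eq_map_trajMeasure
    (X := fun _ => Fin K × ℝ) (μ₀ := firstLaw ν π) (κ := stepKernel ν π) (a := n)
  have h' : ∫⁻ p, F p ∂((law ν π).map (Preorder.frestrictLe n) ⊗ₘ stepKernel ν π n) =
      ∫⁻ p, F p ∂((law ν π).map fun ω => (Preorder.frestrictLe n ω, ω (n + 1))) := by
    unfold law; rw [h]
  rw [lintegral_map hF (by fun_prop), Measure.lintegral_compProd hF,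
    lintegral_map _ (by fun_prop)] at h'
  · exact h'.symm
  · exact hF.lintegral_kernel_prod_right'

/-- One round of interaction: if `V` depends on the past of round `n` only, the pair played in
round `n` may be integrated out, first the reward and then the arm. -/
lemma lintegral_law_step (ν : Env K) (π : Policy K) (n : ℕ)
    {V : (ℕ → Fin K × ℝ) → Fin K × ℝ → ℝ≥0∞} (hV : Measurable (Function.uncurry V))
    (hdep : ∀ y, DependsOn (fun ω => V ω y) (Set.Iio n)) :
    ∫⁻ ω, V ω (ω n) ∂(law ν π) =
      ∫⁻ ω, ∫⁻ a, ∫⁻ x, V ω (a, x) ∂(ν a : Measure ℝ) ∂(π.armKernel n ω) ∂(law ν π) := by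
  have : Nonempty (ℕ → Fin K × ℝ) := nonempty_of_isProbabilityMeasure (law ν π)
  obtain ⟨ω₀⟩ := this
  cases n with
  | zero =>
    have e : ∀ ω y, V ω y = V ω₀ y := fun ω y => hdep y (by simp)
    have hm : Measurable (V ω₀) := hV.comp (by fun_prop : Measurable fun y => (ω₀, y))
    calc ∫⁻ ω, V ω (ω 0) ∂(law ν π) = ∫⁻ ω, V ω₀ (ω 0) ∂(law ν π) := by simp only [e]
      _ = ∫⁻ a, ∫⁻ x, V ω₀ (a, x) ∂(ν a : Measure ℝ) ∂π.init := by
        rw [lintegral_law_first ν π hm, firstLaw, Measure.lintegral_compProd hm]; rfl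
      _ = _ := by
        simp only [Policy.armKernel, Kernel.const_apply, e, lintegral_const, measure_univ, mul_one]
  | succ n =>
    classical
    -- a trajectory that agrees with `ω` up to time `n`
    set ext : (Finset.Iic n → Fin K × ℝ) → (ℕ → Fin K × ℝ) :=
      fun h => Function.updateFinset ω₀ (Finset.Iic n) h with hext
    have mext : Measurable ext := measurable_updateFinset
    have e : ∀ ω y, V ω y = V (ext (Preorder.frestrictLe n ω)) y := fun ω y => hdep y (by
      intro i hi
      have : i ≤ n := by simp at hi; omega
      simp [hext, Function.updateFinset, this])
    have hm : Measurable (fun p : (Finset.Iic n → Fin K × ℝ) × (Fin K × ℝ) => V (ext p.1) p.2) :=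
      hV.comp (by fun_prop : Measurable fun p : (Finset.Iic n → Fin K × ℝ) × (Fin K × ℝ) =>
        (ext p.1, p.2))
    calc ∫⁻ ω, V ω (ω (n + 1)) ∂(law ν π)
        = ∫⁻ ω, V (ext (Preorder.frestrictLe n ω)) (ω (n + 1)) ∂(law ν π) := by
          simp only [← e]
      _ = ∫⁻ ω, ∫⁻ y, V (ext (Preorder.frestrictLe n ω)) y
            ∂(stepKernel ν π n (Preorder.frestrictLe n ω)) ∂(law ν π) :=
          lintegral_law_succ ν π n hm
      _ = _ := by
        refine lintegral_congr fun ω => ?_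
        have hω : Measurable (V (ext (Preorder.frestrictLe n ω))) :=
          hm.comp (by fun_prop : Measurable fun y : Fin K × ℝ => (Preorder.frestrictLe n ω, y))
        rw [stepKernel, Kernel.lintegral_compProd _ _ _ hω]
        simp only [← e]
        rfl

/-- Given the past and given that arm `k` is played in round `n`, the reward of round `n` has
law `ν k`. -/
lemma lintegral_law_reward (ν : Env K) (π : Policy K) (k : Fin K) (n : ℕ)
    {U : (ℕ → Fin K × ℝ) → ℝ≥0∞} (hU : Measurable U) (hdep : DependsOn U (Set.Iio n))
    {g : ℝ → ℝ≥0∞} (hg : Measurable g) :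
    ∫⁻ ω, U ω * (if (ω n).1 = k then g (ω n).2 else 0) ∂(law ν π) =
      (∫⁻ x, g x ∂(ν k : Measure ℝ)) *
        ∫⁻ ω, U ω * (if (ω n).1 = k then 1 else 0) ∂(law ν π) := by
  have key : ∀ g : ℝ → ℝ≥0∞, Measurable g →
      ∫⁻ ω, U ω * (if (ω n).1 = k then g (ω n).2 else 0) ∂(law ν π) =
        (∫⁻ x, g x ∂(ν k : Measure ℝ)) * ∫⁻ ω, U ω * π.armKernel n ω {k} ∂(law ν π) := by
    intro g hg
    have hV : Measurable (Function.uncurry fun (ω : ℕ → Fin K × ℝ) (y : Fin K × ℝ) =>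
        U ω * (if y.1 = k then g y.2 else 0)) := by
      refine (hU.comp measurable_fst).mul (Measurable.ite ?_ (by fun_prop) (by fun_prop))
      exact (measurable_fst.comp measurable_snd) (MeasurableSet.singleton k)
    rw [lintegral_law_step ν π n hV (fun y x z h => by simp only [hdep h]),
      ← lintegral_const_mul _ (show Measurable fun ω => U ω * π.armKernel n ω {k} from
        hU.mul (Kernel.measurable_coe _ (MeasurableSet.singleton k)))]
    refine lintegral_congr fun ω => ?_
    have : ∀ a : Fin K, ∫⁻ x, U ω * (if a = k then g x else 0) ∂(ν a : Measure ℝ) =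
        Set.indicator {k} (fun _ => U ω * ∫⁻ x, g x ∂(ν k : Measure ℝ)) a := by
      intro a
      by_cases h : a = k
      · subst h; simp [lintegral_const_mul _ hg]
      · simp [h]
    simp only [this]
    rw [lintegral_indicator_const (MeasurableSet.singleton k)]
    ring
  have h1 := key (fun _ => 1) measurable_const
  simp only [lintegral_one, measure_univ, one_mul] at h1
  rw [key g hg, h1]

/-! ### Numbers of plays -/

lemma plays_succ (k : Fin K) (T : ℕ) (ω : ℕ → Fin K × ℝ) :
    plays k (T + 1) ω = plays k T ω + if (ω T).1 = k then 1 else 0 := by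
  unfold plays
  rw [Finset.range_add_one, Finset.filter_insert]
  split_ifs with h <;> simp

lemma plays_le (k : Fin K) (T : ℕ) (ω : ℕ → Fin K × ℝ) : plays k T ω ≤ T :=
  (Finset.card_filter_le _ _).trans (by simp)

lemma plays_mono (k : Fin K) (ω : ℕ → Fin K × ℝ) : Monotone fun T => plays k T ω := by
  refine monotone_nat_of_le_succ fun T => ?_
  rw [plays_succ]
  exact Nat.le_add_right _ _

lemma measurableSet_arm (k : Fin K) (t : ℕ) :
    MeasurableSet {ω : ℕ → Fin K × ℝ | (ω t).1 = k} :=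
  (measurable_fst.comp (measurable_pi_apply t)) (MeasurableSet.singleton k)

lemma measurable_plays (k : Fin K) (T : ℕ) : Measurable (plays k T) := by
  induction T with
  | zero => exact measurable_const
  | succ n ih =>
    rw [show plays k (n + 1) = fun ω => plays k n ω + if (ω n).1 = k then 1 else 0 from
      funext fun ω => plays_succ k n ω]
    exact ih.add (Measurable.ite (measurableSet_arm k n) measurable_const measurable_const)

lemma dependsOn_plays (k : Fin K) (T : ℕ) : DependsOn (plays k T) (Set.Iio T) := by
  intro x y h
  unfold plays
  congr 1
  refine Finset.filter_congr fun t ht => ?_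
  rw [h t (by simpa using ht)]

lemma sum_plays (T : ℕ) (ω : ℕ → Fin K × ℝ) : ∑ i, plays i T ω = T := by
  unfold plays
  rw [← Finset.card_eq_sum_card_fiberwise (fun t _ => Finset.mem_coe.2 (Finset.mem_univ _))]
  simp

lemma integrable_plays (ν : Env K) (π : Policy K) (k : Fin K) (T : ℕ) :
    Integrable (fun ω => (plays k T ω : ℝ)) (law ν π) :=
  Integrable.of_bound (measurable_from_top.comp (measurable_plays k T)).aestronglyMeasurable T
    (ae_of_all _ fun ω => by simpa using plays_le k T ω)

/-! ### Sums over the rewards of one arm -/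

/-- The sum of `g` over the rewards received from arm `k` in the first `T` rounds. -/
def rewardSum (k : Fin K) (g : ℝ → ℝ) (T : ℕ) (ω : ℕ → Fin K × ℝ) : ℝ :=
  ∑ t ∈ Finset.range T, if (ω t).1 = k then g (ω t).2 else 0

/-- The sum of `g` over the rewards received from arm `k` in the first `T` rounds, where only the
first `m` plays of arm `k` count. -/
def stoppedRewardSum (k : Fin K) (m : ℕ) (g : ℝ → ℝ) (T : ℕ) (ω : ℕ → Fin K × ℝ) : ℝ :=
  ∑ t ∈ Finset.range T, if (ω t).1 = k ∧ plays k t ω < m then g (ω t).2 else 0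

lemma rewardSum_succ (k : Fin K) (g : ℝ → ℝ) (T : ℕ) (ω : ℕ → Fin K × ℝ) :
    rewardSum k g (T + 1) ω = rewardSum k g T ω + if (ω T).1 = k then g (ω T).2 else 0 :=
  Finset.sum_range_succ _ _

lemma stoppedRewardSum_succ (k : Fin K) (m : ℕ) (g : ℝ → ℝ) (T : ℕ) (ω : ℕ → Fin K × ℝ) :
    stoppedRewardSum k m g (T + 1) ω = stoppedRewardSum k m g T ω +
      if (ω T).1 = k ∧ plays k T ω < m then g (ω T).2 else 0 :=
  Finset.sum_range_succ _ _

lemma measurableSet_arm_plays (k : Fin K) (m t : ℕ) :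
    MeasurableSet {ω : ℕ → Fin K × ℝ | (ω t).1 = k ∧ plays k t ω < m} :=
  (measurableSet_arm k t).inter (measurable_plays k t measurableSet_Iio)

lemma measurable_rewardSum (k : Fin K) {g : ℝ → ℝ} (hg : Measurable g) (T : ℕ) :
    Measurable (rewardSum k g T) := by
  refine Finset.measurable_sum _ fun t _ => Measurable.ite (measurableSet_arm k t) ?_ ?_
  · exact hg.comp (measurable_snd.comp (measurable_pi_apply t))
  · exact measurable_const

lemma measurable_stoppedRewardSum (k : Fin K) (m : ℕ) {g : ℝ → ℝ} (hg : Measurable g) (T : ℕ) :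
    Measurable (stoppedRewardSum k m g T) := by
  refine Finset.measurable_sum _ fun t _ => Measurable.ite (measurableSet_arm_plays k m t) ?_ ?_
  · exact hg.comp (measurable_snd.comp (measurable_pi_apply t))
  · exact measurable_const

lemma dependsOn_rewardSum (k : Fin K) (g : ℝ → ℝ) (T : ℕ) :
    DependsOn (rewardSum k g T) (Set.Iio T) := by
  intro x y h
  refine Finset.sum_congr rfl fun t ht => ?_
  rw [h t (by simpa using ht)]

lemma dependsOn_stoppedRewardSum (k : Fin K) (m : ℕ) (g : ℝ → ℝ) (T : ℕ) :
    DependsOn (stoppedRewardSum k m g T) (Set.Iio T) := by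
  intro x y h
  refine Finset.sum_congr rfl fun t ht => ?_
  have ht : t < T := by simpa using ht
  rw [h t ht, dependsOn_plays k t fun i hi => h i (lt_trans hi ht)]

lemma stoppedRewardSum_eq_rewardSum {k : Fin K} {m T : ℕ} {ω : ℕ → Fin K × ℝ}
    (h : plays k T ω ≤ m) (g : ℝ → ℝ) : stoppedRewardSum k m g T ω = rewardSum k g T ω := by
  refine Finset.sum_congr rfl fun t ht => ?_
  have h1 := plays_mono k ω (Finset.mem_range.1 ht : t + 1 ≤ T)
  simp only [plays_succ] at h1
  by_cases hk : (ω t).1 = k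
  · rw [if_pos hk] at h1
    rw [if_pos hk, if_pos ⟨hk, by omega⟩]
  · simp [hk]

lemma stoppedRewardSum_one (k : Fin K) (m T : ℕ) (ω : ℕ → Fin K × ℝ) :
    stoppedRewardSum k m (fun _ => 1) T ω = (min (plays k T ω) m : ℕ) := by
  induction T with
  | zero => simp [stoppedRewardSum, plays]
  | succ n ih =>
    rw [stoppedRewardSum_succ, ih, plays_succ]
    by_cases h1 : (ω n).1 = k <;> by_cases h2 : plays k n ω < m
    · rw [if_pos ⟨h1, h2⟩, if_pos h1, min_eq_left h2.le, min_eq_left h2]; simp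
    · rw [if_neg (fun h => h2 h.2), min_eq_right (not_lt.1 h2), min_eq_right (by omega)]; simp
    · simp [h1]
    · simp [h1]

lemma stoppedRewardSum_one_le (k : Fin K) (m T : ℕ) (ω : ℕ → Fin K × ℝ) :
    stoppedRewardSum k m (fun _ => 1) T ω ≤ m := by
  rw [stoppedRewardSum_one]
  exact_mod_cast min_le_right _ _

lemma stoppedRewardSum_sub_const (k : Fin K) (m : ℕ) (g : ℝ → ℝ) (a b : ℝ) (T : ℕ)
    (ω : ℕ → Fin K × ℝ) :
    stoppedRewardSum k m (fun x => a * g x - b) T ω =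
      a * stoppedRewardSum k m g T ω - b * stoppedRewardSum k m (fun _ => 1) T ω := by
  unfold stoppedRewardSum
  rw [Finset.mul_sum, Finset.mul_sum, ← Finset.sum_sub_distrib]
  refine Finset.sum_congr rfl fun t _ => ?_
  split_ifs <;> ring

lemma stoppedRewardSum_nonneg (k : Fin K) (m : ℕ) {g : ℝ → ℝ} (hg : 0 ≤ g) (T : ℕ)
    (ω : ℕ → Fin K × ℝ) : 0 ≤ stoppedRewardSum k m g T ω :=
  Finset.sum_nonneg fun t _ => by split_ifs; exacts [hg _, le_rfl]

lemma stoppedRewardSum_le_add (k : Fin K) (m : ℕ) {f g h : ℝ → ℝ} (hfg : ∀ x, f x ≤ g x + h x)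
    (T : ℕ) (ω : ℕ → Fin K × ℝ) :
    stoppedRewardSum k m f T ω ≤ stoppedRewardSum k m g T ω + stoppedRewardSum k m h T ω := by
  unfold stoppedRewardSum
  rw [← Finset.sum_add_distrib]
  refine Finset.sum_le_sum fun t _ => ?_
  split_ifs
  · exact hfg _
  · simp

/-! ### Moments of the stopped sums -/

/-- The exponential of a stopped sum is a supermartingale as soon as the rewards of arm `k` have
exponential moment at most `1`. -/
lemma lintegral_exp_stoppedRewardSum_le_one (ν : Env K) (π : Policy K) (k : Fin K) (m : ℕ)
    {g : ℝ → ℝ} (hg : Measurable g)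
    (h1 : ∫⁻ x, ENNReal.ofReal (Real.exp (g x)) ∂(ν k : Measure ℝ) ≤ 1) (T : ℕ) :
    ∫⁻ ω, ENNReal.ofReal (Real.exp (stoppedRewardSum k m g T ω)) ∂(law ν π) ≤ 1 := by
  induction T with
  | zero => simp [stoppedRewardSum]
  | succ n ih =>
    set W : (ℕ → Fin K × ℝ) → ℝ≥0∞ :=
      fun ω => ENNReal.ofReal (Real.exp (stoppedRewardSum k m g n ω)) with hW
    have mW : Measurable W := (measurable_stoppedRewardSum k m hg n).exp.ennreal_ofReal
    set U : (ℕ → Fin K × ℝ) → ℝ≥0∞ := fun ω => if plays k n ω < m then W ω else 0 with hU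
    have mU : Measurable U :=
      Measurable.ite (measurable_plays k n measurableSet_Iio) mW measurable_const
    have dU : DependsOn U (Set.Iio n) := fun x y h => by
      simp only [hU, hW, dependsOn_plays k n h, dependsOn_stoppedRewardSum k m g n h]
    set R : (ℕ → Fin K × ℝ) → ℝ≥0∞ :=
      fun ω => if (ω n).1 = k ∧ plays k n ω < m then 0 else W ω with hR
    have mR : Measurable R := Measurable.ite (measurableSet_arm_plays k m n) measurable_const mW
    have mg : Measurable fun x => ENNReal.ofReal (Real.exp (g x)) := hg.exp.ennreal_ofReal
    calc ∫⁻ ω, ENNReal.ofReal (Real.exp (stoppedRewardSum k m g (n + 1) ω)) ∂(law ν π)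
        = ∫⁻ ω, (U ω * (if (ω n).1 = k then ENNReal.ofReal (Real.exp (g (ω n).2)) else 0)
            + R ω) ∂(law ν π) := by
          refine lintegral_congr fun ω => ?_
          rw [stoppedRewardSum_succ, Real.exp_add, ENNReal.ofReal_mul (Real.exp_pos _).le]
          by_cases hk : (ω n).1 = k <;> by_cases hp : plays k n ω < m <;>
            simp [hU, hR, hW, hk, hp]
      _ = (∫⁻ x, ENNReal.ofReal (Real.exp (g x)) ∂(ν k : Measure ℝ)) *
            (∫⁻ ω, U ω * (if (ω n).1 = k then 1 else 0) ∂(law ν π)) + ∫⁻ ω, R ω ∂(law ν π) := by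
          rw [lintegral_add_right _ mR, lintegral_law_reward ν π k n mU dU mg]
      _ ≤ (∫⁻ ω, U ω * (if (ω n).1 = k then 1 else 0) ∂(law ν π)) + ∫⁻ ω, R ω ∂(law ν π) := by
          gcongr
          exact mul_le_of_le_one_left (zero_le) h1
      _ = ∫⁻ ω, W ω ∂(law ν π) := by
          rw [← lintegral_add_right _ mR]
          refine lintegral_congr fun ω => ?_
          by_cases hk : (ω n).1 = k <;> by_cases hp : plays k n ω < m <;>
            simp [hU, hR, hk, hp]
      _ ≤ 1 := ih

/-- Wald's identity for the stopped sums of a nonnegative function of the rewards. -/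
lemma lintegral_stoppedRewardSum (ν : Env K) (π : Policy K) (k : Fin K) (m : ℕ)
    {g : ℝ → ℝ} (hg : Measurable g) (h0 : 0 ≤ g) (T : ℕ) :
    ∫⁻ ω, ENNReal.ofReal (stoppedRewardSum k m g T ω) ∂(law ν π) =
      (∫⁻ x, ENNReal.ofReal (g x) ∂(ν k : Measure ℝ)) *
        ∫⁻ ω, ENNReal.ofReal (stoppedRewardSum k m (fun _ => 1) T ω) ∂(law ν π) := by
  induction T with
  | zero => simp [stoppedRewardSum]
  | succ n ih =>
    set U : (ℕ → Fin K × ℝ) → ℝ≥0∞ := fun ω => if plays k n ω < m then 1 else 0 with hU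
    have mU : Measurable U :=
      Measurable.ite (measurable_plays k n measurableSet_Iio) measurable_const measurable_const
    have dU : DependsOn U (Set.Iio n) := fun x y h => by
      simp only [hU, dependsOn_plays k n h]
    have split : ∀ f : ℝ → ℝ, Measurable f → 0 ≤ f →
        ∫⁻ ω, ENNReal.ofReal (stoppedRewardSum k m f (n + 1) ω) ∂(law ν π) =
          ∫⁻ ω, ENNReal.ofReal (stoppedRewardSum k m f n ω) ∂(law ν π) +
            (∫⁻ x, ENNReal.ofReal (f x) ∂(ν k : Measure ℝ)) *
              ∫⁻ ω, U ω * (if (ω n).1 = k then 1 else 0) ∂(law ν π) := by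
      intro f hf f0
      rw [← lintegral_law_reward ν π k n mU dU hf.ennreal_ofReal,
        ← lintegral_add_left (measurable_stoppedRewardSum k m hf n).ennreal_ofReal]
      refine lintegral_congr fun ω => ?_
      rw [stoppedRewardSum_succ, ENNReal.ofReal_add (stoppedRewardSum_nonneg k m f0 n ω)
        (by split_ifs; exacts [f0 _, le_rfl])]
      by_cases hk : (ω n).1 = k <;> by_cases hp : plays k n ω < m <;> simp [hU, hk, hp]
    rw [split g hg h0, split (fun _ => 1) measurable_const (fun _ => zero_le_one), ih]
    simp only [ENNReal.ofReal_one, lintegral_one, measure_univ, one_mul]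
    ring

/-! ### Change of measure -/

/-- Change of measure: if `ν` and `ν'` differ in arm `k` only, and the reward distribution of that
arm in `ν` has density at most `exp ∘ Y` with respect to the one in `ν'`, then on the events of the
first `T` rounds the density of `law ν π` with respect to `law ν' π` is at most the exponential of
the sum of `Y` over the rewards received from arm `k`. -/
lemma lintegral_law_le_lintegral_law {ν ν' : Env K} (π : Policy K) {k : Fin K}
    (hne : ∀ i, i ≠ k → ν i = ν' i) {Y : ℝ → ℝ} (hY : Measurable Y)
    (hk : (ν k : Measure ℝ) ≤
      (ν' k : Measure ℝ).withDensity fun x => ENNReal.ofReal (Real.exp (Y x)))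
    (T : ℕ) {F : (ℕ → Fin K × ℝ) → ℝ≥0∞} (hF : Measurable F) (hdep : DependsOn F (Set.Iio T)) :
    ∫⁻ ω, F ω ∂(law ν π) ≤
      ∫⁻ ω, F ω * ENNReal.ofReal (Real.exp (rewardSum k Y T ω)) ∂(law ν' π) := by
  classical
  induction T generalizing F with
  | zero =>
    have : Nonempty (ℕ → Fin K × ℝ) := nonempty_of_isProbabilityMeasure (law ν π)
    obtain ⟨ω₀⟩ := this
    have e : ∀ ω, F ω = F ω₀ := fun ω => hdep (by simp)
    simp [e, rewardSum]
  | succ n ih =>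
    set V : (ℕ → Fin K × ℝ) → Fin K × ℝ → ℝ≥0∞ := fun ω y => F (Function.update ω n y) with hV
    have mupd : Measurable fun p : (ℕ → Fin K × ℝ) × (Fin K × ℝ) =>
        Function.update p.1 n p.2 := by
      refine measurable_pi_lambda _ fun i => ?_
      by_cases h : i = n
      · subst h; simpa using measurable_snd
      · simp only [Function.update_of_ne h]
        exact (measurable_pi_apply i).comp measurable_fst
    have mV : Measurable (Function.uncurry V) := hF.comp mupd
    have dV : ∀ y, DependsOn (fun ω => V ω y) (Set.Iio n) := fun y x z h => by
      refine hdep fun i hi => ?_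
      by_cases hin : i = n
      · subst hin; simp
      · simpa [hin] using h i (lt_of_le_of_ne (Nat.lt_succ_iff.1 hi) hin)
    have eV : ∀ ω, V ω (ω n) = F ω := fun ω => by simp [hV]
    -- the density of one round
    set D : Fin K × ℝ → ℝ≥0∞ :=
      fun y => if y.1 = k then ENNReal.ofReal (Real.exp (Y y.2)) else 1 with hD
    have mD : Measurable D := Measurable.ite (measurable_fst (MeasurableSet.singleton k))
      (hY.comp measurable_snd).exp.ennreal_ofReal measurable_const
    set L : (ℕ → Fin K × ℝ) → ℝ≥0∞ :=
      fun ω => ENNReal.ofReal (Real.exp (rewardSum k Y n ω)) with hL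
    have mL : Measurable L := (measurable_rewardSum k hY n).exp.ennreal_ofReal
    set G : (ℕ → Fin K × ℝ) → ℝ≥0∞ :=
      fun ω => ∫⁻ a, ∫⁻ x, V ω (a, x) ∂(ν a : Measure ℝ) ∂(π.armKernel n ω) with hG
    have mG : Measurable G := by
      have m1 : Measurable fun p : (ℕ → Fin K × ℝ) × Fin K =>
          ∫⁻ x, V p.1 (p.2, x) ∂(Kernel.prodMkLeft (ℕ → Fin K × ℝ) ν.rewardKernel p) := by
        refine Measurable.lintegral_kernel_prod_right
          (f := fun (p : (ℕ → Fin K × ℝ) × Fin K) (x : ℝ) => V p.1 (p.2, x)) ?_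
        exact mV.comp (by fun_prop :
          Measurable fun q : ((ℕ → Fin K × ℝ) × Fin K) × ℝ => (q.1.1, (q.1.2, q.2)))
      exact m1.lintegral_kernel_prod_right'
    have dG : DependsOn G (Set.Iio n) := fun x z h => by
      have h1 := π.dependsOn_armKernel n h
      have h2 : ∀ y, V x y = V z y := fun y => dV y h
      simp only at h1
      simp only [hG, h1, h2]
    calc ∫⁻ ω, F ω ∂(law ν π) = ∫⁻ ω, G ω ∂(law ν π) := by
          rw [hG, ← lintegral_law_step ν π n mV dV]
          simp only [eV]
      _ ≤ ∫⁻ ω, G ω * L ω ∂(law ν' π) := ih mG dG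
      _ ≤ ∫⁻ ω, ∫⁻ a, ∫⁻ x, V ω (a, x) * D (a, x) * L ω ∂(ν' a : Measure ℝ) ∂(π.armKernel n ω)
            ∂(law ν' π) := by
          refine lintegral_mono fun ω => ?_
          have mVω : ∀ a, Measurable fun x => V ω (a, x) := fun a =>
            mV.comp (by fun_prop : Measurable fun x : ℝ => (ω, (a, x)))
          have mDa : ∀ a, Measurable fun x => D (a, x) := fun a =>
            mD.comp (by fun_prop : Measurable fun x : ℝ => (a, x))
          rw [hG, ← lintegral_mul_const _ (measurable_of_finite _)]
          refine lintegral_mono fun a => ?_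
          rw [lintegral_mul_const _
            (show Measurable fun x => V ω (a, x) * D (a, x) from (mVω a).mul (mDa a))]
          refine mul_le_mul_left ?_ _
          by_cases ha : a = k
          · subst ha
            calc _ ≤ ∫⁻ x, V ω (a, x) ∂((ν' a : Measure ℝ).withDensity
                    fun x => ENNReal.ofReal (Real.exp (Y x))) := lintegral_mono' hk le_rfl
              _ = _ := by
                rw [lintegral_withDensity_eq_lintegral_mul _ hY.exp.ennreal_ofReal (mVω a)]
                refine lintegral_congr fun x => ?_
                simp [hD, mul_comm]
          · simp [hD, ha, hne a ha]
      _ = ∫⁻ ω, V ω (ω n) * D (ω n) * L ω ∂(law ν' π) := by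
          refine (lintegral_law_step ν' π n (V := fun ω y => V ω y * D y * L ω) ?_ ?_).symm
          · exact (mV.mul (mD.comp measurable_snd)).mul (mL.comp measurable_fst)
          · intro y x z h
            have h1 := dV y h
            simp only at h1
            simp only [hL, h1, dependsOn_rewardSum k Y n h]
      _ = _ := by
          refine lintegral_congr fun ω => ?_
          rw [eV, rewardSum_succ, Real.exp_add, ENNReal.ofReal_mul (Real.exp_pos _).le, mul_assoc,
            mul_comm (D _)]
          congr 2
          by_cases h : (ω n).1 = k <;> simp [hD, h]

/-! ### A weak law of large numbers for the rewards of one arm -/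

lemma exists_integral_abs_sub_le {P : Measure ℝ} {Y : ℝ → ℝ}
    (hYi : Integrable Y P) {ρ : ℝ} (hρ : 0 < ρ) :
    ∃ B : ℝ, 0 < B ∧ ∫ x, max (|Y x| - B) 0 ∂P ≤ ρ := by
  have h : Tendsto (fun n : ℕ => ∫ x, max (|Y x| - n) 0 ∂P) atTop (𝓝 (∫ _, (0 : ℝ) ∂P)) := by
    refine tendsto_integral_of_dominated_convergence (fun x => |Y x|) ?_ hYi.abs ?_ ?_
    · intro n
      exact (hYi.abs.aestronglyMeasurable.sub aestronglyMeasurable_const).sup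
        aestronglyMeasurable_const
    · intro n
      refine ae_of_all _ fun x => ?_
      rw [Real.norm_eq_abs, abs_of_nonneg (le_max_right _ _)]
      exact max_le (by linarith [(Nat.cast_nonneg n : (0 : ℝ) ≤ n)]) (abs_nonneg _)
    · refine ae_of_all _ fun x => tendsto_const_nhds.congr' ?_
      filter_upwards [eventually_ge_atTop ⌈|Y x|⌉₊] with n hn
      exact (max_eq_right (by linarith [Nat.ceil_le.1 hn])).symm
  rw [integral_zero] at h
  obtain ⟨n, hn, hn0⟩ := ((h.eventually_le_const hρ).and (eventually_gt_atTop 0)).exists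
  exact ⟨n, by exact_mod_cast hn0, hn⟩

/-- Hoeffding's lemma, as a bound on the exponential moment of an affine function. -/
lemma lintegral_exp_mul_sub_le_one {P : Measure ℝ} [IsProbabilityMeasure P] {Z : ℝ → ℝ}
    (hZ : Measurable Z) {B : ℝ} (hB : ∀ x, Z x ∈ Set.Icc (-B) B) {l b : ℝ}
    (hb : l * ∫ x, Z x ∂P + B ^ 2 * l ^ 2 / 2 ≤ b) :
    ∫⁻ x, ENNReal.ofReal (Real.exp (l * Z x - b)) ∂P ≤ 1 := by
  have hs := hasSubgaussianMGF_of_mem_Icc (μ := P) hZ.aemeasurable (ae_of_all _ hB)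
  have h1 := hs.mgf_le l
  have hi := hs.integrable_exp_mul l
  have hc : (((‖B - -B‖₊ / 2) ^ 2 : NNReal) : ℝ) = B ^ 2 := by
    push_cast
    rw [Real.norm_eq_abs, div_pow, sq_abs]
    ring
  rw [hc, mgf] at h1
  have e : ∀ x, Real.exp (l * Z x - b) =
      Real.exp (l * (Z x - ∫ y, Z y ∂P)) * Real.exp (l * (∫ y, Z y ∂P) - b) := fun x => by
    rw [← Real.exp_add]; congr 1; ring
  simp_rw [e]
  rw [← ofReal_integral_eq_lintegral_ofReal (hi.mul_const _)
    (ae_of_all _ fun x => by positivity), integral_mul_const, ← ENNReal.ofReal_one]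
  refine ENNReal.ofReal_le_ofReal ?_
  calc _ ≤ Real.exp (B ^ 2 * l ^ 2 / 2) * Real.exp (l * (∫ y, Z y ∂P) - b) := by gcongr
    _ ≤ 1 := by
      rw [← Real.exp_add, Real.exp_le_one_iff]
      linarith

/-- Weak law of large numbers for the rewards of one arm, uniformly in the horizon: while arm `k`
has been played at most `m` times, the sum of `Y` over its rewards is at most `m * (D + ε)` with
probability close to one, if `Y` has mean at most `D`. -/
lemma exists_law_rewardSum_gt_le (ν : Env K) (π : Policy K) (k : Fin K) {Y : ℝ → ℝ}
    (hY : Measurable Y) (hYi : Integrable Y (ν k : Measure ℝ)) {D : ℝ} (hD0 : 0 ≤ D)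
    (hD : ∫ x, Y x ∂(ν k : Measure ℝ) ≤ D) {ε δ : ℝ} (hε : 0 < ε) (hδ : 0 < δ) :
    ∃ m₀ : ℕ, ∀ m, m₀ ≤ m → ∀ T,
      law ν π {ω | plays k T ω ≤ m ∧ m * (D + ε) < rewardSum k Y T ω} ≤ ENNReal.ofReal δ := by
  set ρ : ℝ := min (ε * δ / 4) (ε / 4) with hρ
  have hρ0 : 0 < ρ := lt_min (by positivity) (by positivity)
  obtain ⟨B, hB0, hB⟩ := exists_integral_abs_sub_le hYi hρ0
  -- `Y ≤ Z + R` with `Z` bounded and `R` of small mean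
  set R : ℝ → ℝ := fun x => max (|Y x| - B) 0 with hR
  set Z : ℝ → ℝ := fun x => max (min (Y x) B) (-B) with hZ
  have mR : Measurable R := by fun_prop
  have mZ : Measurable Z := by fun_prop
  have R0 : 0 ≤ R := fun x => le_max_right _ _
  have iR : Integrable R (ν k : Measure ℝ) := by
    refine hYi.abs.mono mR.aestronglyMeasurable (ae_of_all _ fun x => ?_)
    rw [Real.norm_eq_abs, abs_of_nonneg (R0 x), Real.norm_eq_abs, abs_abs]
    exact max_le (by linarith) (abs_nonneg _)
  have bZ : ∀ x, Z x ∈ Set.Icc (-B) B := fun x =>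
    ⟨le_max_right _ _, max_le (min_le_right _ _) (by linarith)⟩
  have YZR : ∀ x, Y x ≤ Z x + R x := fun x => by
    have h1 : min (Y x) B ≤ Z x := le_max_left _ _
    have h2 : |Y x| - B ≤ R x := le_max_left _ _
    have h3 := R0 x
    have h4 := le_abs_self (Y x)
    simp only [Pi.zero_apply] at h3
    rcases min_cases (Y x) B with ⟨h, _⟩ | ⟨h, _⟩ <;> rw [h] at h1 <;> linarith
  have ZYR : ∀ x, Z x ≤ Y x + R x := fun x => by
    have h2 : |Y x| - B ≤ R x := le_max_left _ _
    have h3 := R0 x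
    have h4 := neg_abs_le (Y x)
    simp only [Pi.zero_apply] at h3
    exact max_le ((min_le_left _ _).trans (by linarith)) (by linarith)
  have iZ : Integrable Z (ν k : Measure ℝ) :=
    Integrable.of_mem_Icc (-B) B mZ.aemeasurable (ae_of_all _ bZ)
  have hZm : ∫ x, Z x ∂(ν k : Measure ℝ) ≤ D + ε / 4 := by
    calc _ ≤ ∫ x, Y x + R x ∂(ν k : Measure ℝ) := integral_mono iZ (hYi.add iR) ZYR
      _ = (∫ x, Y x ∂(ν k : Measure ℝ)) + ∫ x, R x ∂(ν k : Measure ℝ) := integral_add hYi iR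
      _ ≤ D + ε / 4 := add_le_add hD (hB.trans (min_le_right _ _))
  -- the exponent `l` makes the second-order term `B ^ 2 * l ^ 2 / 2` equal to `l * ε / 8`
  set l : ℝ := ε / (4 * B ^ 2) with hl
  have hl0 : 0 < l := by positivity
  have hlB : B ^ 2 * l ^ 2 / 2 = l * (ε / 8) := by rw [hl]; field_simp; ring
  have hexp : ∫⁻ x, ENNReal.ofReal (Real.exp (l * Z x - l * (D + 3 * ε / 8)))
      ∂(ν k : Measure ℝ) ≤ 1 := by
    refine lintegral_exp_mul_sub_le_one mZ bZ ?_
    rw [hlB]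
    nlinarith [mul_le_mul_of_nonneg_left hZm hl0.le]
  have htend : Tendsto (fun m : ℕ => Real.exp (-(l * ε / 8 * m))) atTop (𝓝 0) :=
    Real.tendsto_exp_neg_atTop_nhds_zero.comp
      (tendsto_natCast_atTop_atTop.const_mul_atTop (by positivity))
  obtain ⟨m₀, hm₀⟩ := eventually_atTop.1
    ((htend.eventually_le_const (half_pos hδ)).and (eventually_gt_atTop 0))
  refine ⟨m₀, fun m hm T => ?_⟩
  obtain ⟨hm1, hm0⟩ := hm₀ m hm
  have hmR : (0 : ℝ) < m := by exact_mod_cast hm0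
  have boundZ : law ν π {ω | m * (D + ε / 2) ≤ stoppedRewardSum k m Z T ω} ≤
      ENNReal.ofReal (δ / 2) := by
    have hM := lintegral_exp_stoppedRewardSum_le_one ν π k m
      (g := fun x => l * Z x - l * (D + 3 * ε / 8)) (by fun_prop) hexp T
    have mS := measurable_stoppedRewardSum k m
      (g := fun x => l * Z x - l * (D + 3 * ε / 8)) (by fun_prop) T
    calc _ ≤ law ν π {ω | ENNReal.ofReal (Real.exp (l * ε / 8 * m)) ≤ ENNReal.ofReal
            (Real.exp (stoppedRewardSum k m (fun x => l * Z x - l * (D + 3 * ε / 8)) T ω))} := by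
          refine measure_mono fun ω hω => ENNReal.ofReal_le_ofReal (Real.exp_le_exp.2 ?_)
          rw [stoppedRewardSum_sub_const]
          have h1 := mul_le_mul_of_nonneg_left (Set.mem_ofPred.1 hω) hl0.le
          have h2 := mul_le_mul_of_nonneg_left (stoppedRewardSum_one_le k m T ω)
            (by positivity : 0 ≤ l * (D + 3 * ε / 8))
          nlinarith
      _ ≤ 1 / ENNReal.ofReal (Real.exp (l * ε / 8 * m)) := by
          refine (meas_ge_le_lintegral_div mS.exp.ennreal_ofReal.aemeasurable
            (by simp [Real.exp_pos]) ENNReal.ofReal_ne_top).trans ?_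
          exact ENNReal.div_le_div_right hM _
      _ = ENNReal.ofReal (Real.exp (-(l * ε / 8 * m))) := by
          rw [one_div, Real.exp_neg, ENNReal.ofReal_inv_of_pos (Real.exp_pos _)]
      _ ≤ _ := ENNReal.ofReal_le_ofReal hm1
  have boundR : law ν π {ω | m * (ε / 2) ≤ stoppedRewardSum k m R T ω} ≤
      ENNReal.ofReal (δ / 2) := by
    have mS := measurable_stoppedRewardSum k m mR T
    have hS : ∫⁻ ω, ENNReal.ofReal (stoppedRewardSum k m R T ω) ∂(law ν π) ≤
        ENNReal.ofReal (ρ * m) := by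
      rw [lintegral_stoppedRewardSum ν π k m mR R0, ENNReal.ofReal_mul hρ0.le,
        ← ofReal_integral_eq_lintegral_ofReal iR (ae_of_all _ R0)]
      refine mul_le_mul' (ENNReal.ofReal_le_ofReal hB) ?_
      calc _ ≤ ∫⁻ _, ENNReal.ofReal m ∂(law ν π) :=
            lintegral_mono fun ω => ENNReal.ofReal_le_ofReal (stoppedRewardSum_one_le k m T ω)
        _ = ENNReal.ofReal m := by simp
    calc _ ≤ law ν π {ω | ENNReal.ofReal (m * (ε / 2)) ≤
            ENNReal.ofReal (stoppedRewardSum k m R T ω)} :=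
          measure_mono fun ω hω => ENNReal.ofReal_le_ofReal hω
      _ ≤ ENNReal.ofReal (ρ * m) / ENNReal.ofReal (m * (ε / 2)) := by
          refine (meas_ge_le_lintegral_div mS.ennreal_ofReal.aemeasurable
            (ENNReal.ofReal_pos.2 (by positivity)).ne' ENNReal.ofReal_ne_top).trans ?_
          exact ENNReal.div_le_div_right hS _
      _ = ENNReal.ofReal (ρ * m / (m * (ε / 2))) :=
          (ENNReal.ofReal_div_of_pos (by positivity)).symm
      _ ≤ _ := by
          refine ENNReal.ofReal_le_ofReal ?_
          rw [div_le_iff₀ (by positivity)]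
          nlinarith [mul_le_mul_of_nonneg_right (min_le_left (ε * δ / 4) (ε / 4)) hmR.le]
  calc _ ≤ law ν π ({ω | m * (D + ε / 2) ≤ stoppedRewardSum k m Z T ω} ∪
          {ω | m * (ε / 2) ≤ stoppedRewardSum k m R T ω}) := by
        refine measure_mono fun ω hω => ?_
        by_contra hcon
        simp only [Set.mem_union, Set.mem_ofPred_eq, not_or, not_le] at hcon
        have h1 := stoppedRewardSum_le_add k m YZR T ω
        rw [stoppedRewardSum_eq_rewardSum hω.1] at h1
        have h2 := hω.2
        nlinarith [hcon.1, hcon.2]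
    _ ≤ ENNReal.ofReal (δ / 2) + ENNReal.ofReal (δ / 2) :=
        (measure_union_le _ _).trans (add_le_add boundZ boundR)
    _ = ENNReal.ofReal δ := by
        rw [← ENNReal.ofReal_add (by positivity) (by positivity), add_halves]

/-! ### Transfer of probabilities between two environments -/

lemma le_withDensity_exp_llr {P Q : Measure ℝ} [SigmaFinite P] [SigmaFinite Q] (h : P ≪ Q) :
    P ≤ Q.withDensity fun x => ENNReal.ofReal (Real.exp (llr P Q x)) := by
  conv_lhs => rw [← Measure.withDensity_rnDeriv_eq P Q h]
  refine withDensity_mono ?_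
  filter_upwards [Measure.rnDeriv_lt_top P Q] with x hx
  rw [← ENNReal.ofReal_toReal hx.ne]
  exact ENNReal.ofReal_le_ofReal (Real.le_exp_log _)

/-- The likelihood-ratio bound for two environments that differ in arm `k` only. -/
lemma law_le_exp_mul_law {ν ν' : Env K} (π : Policy K) {k : Fin K}
    (hne : ∀ i, i ≠ k → ν i = ν' i) {Y : ℝ → ℝ} (hY : Measurable Y)
    (hk : (ν k : Measure ℝ) ≤
      (ν' k : Measure ℝ).withDensity fun x => ENNReal.ofReal (Real.exp (Y x)))
    (T m : ℕ) (x : ℝ) :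
    law ν π {ω | plays k T ω ≤ m ∧ rewardSum k Y T ω ≤ x} ≤
      ENNReal.ofReal (Real.exp x) * law ν' π {ω | plays k T ω ≤ m} := by
  have mA : MeasurableSet {ω | plays k T ω ≤ m ∧ rewardSum k Y T ω ≤ x} :=
    (measurable_plays k T measurableSet_Iic).inter
      (measurable_rewardSum k hY T measurableSet_Iic)
  have mC : MeasurableSet {ω | plays k T ω ≤ m} := measurable_plays k T measurableSet_Iic
  rw [← lintegral_indicator_one mA, ← lintegral_indicator_one mC,
    ← lintegral_const_mul _ (measurable_one.indicator mC)]
  refine (lintegral_law_le_lintegral_law π hne hY hk T (measurable_one.indicator mA) ?_).trans ?_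
  · intro y z h
    simp only [Set.indicator, Set.mem_ofPred_eq, dependsOn_plays k T h,
      dependsOn_rewardSum k Y T h, Pi.one_apply]
  · refine lintegral_mono fun ω => ?_
    by_cases hω : ω ∈ {ω | plays k T ω ≤ m ∧ rewardSum k Y T ω ≤ x}
    · have h1 : ω ∈ {ω | plays k T ω ≤ m} := hω.1
      simp only [Set.indicator_of_mem hω, Set.indicator_of_mem h1, Pi.one_apply, one_mul, mul_one]
      exact ENNReal.ofReal_le_ofReal (Real.exp_le_exp.2 hω.2)
    · simp [Set.indicator_of_notMem hω]

/-- Few plays of arm `k` mean many plays of the other arms, so Markov's inequality applies. -/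
lemma law_plays_le_le (ν : Env K) (π : Policy K) (k : Fin K) {T m : ℕ} (h : m < T) :
    law ν π {ω | plays k T ω ≤ m} ≤
      ENNReal.ofReal ((∑ i ∈ Finset.univ.erase k, expectedPlays ν π i T) / (T - m)) := by
  have hTm : (0 : ℝ) < T - m := sub_pos.2 (by exact_mod_cast h)
  have hi : Integrable (fun ω => ∑ i ∈ Finset.univ.erase k, (plays i T ω : ℝ)) (law ν π) :=
    integrable_finsetSum _ fun i _ => integrable_plays ν π i T
  have hM := mul_meas_ge_le_integral_of_nonneg (μ := law ν π)
    (ae_of_all _ fun ω => Finset.sum_nonneg fun i _ => Nat.cast_nonneg (plays i T ω)) hi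
    ((T : ℝ) - m)
  rw [integral_finsetSum _ fun i _ => integrable_plays ν π i T] at hM
  calc _ ≤ law ν π {ω | (T : ℝ) - m ≤ ∑ i ∈ Finset.univ.erase k, (plays i T ω : ℝ)} := by
        refine measure_mono fun ω hω => ?_
        have h1 := Finset.add_sum_erase Finset.univ (fun i => plays i T ω) (Finset.mem_univ k)
        rw [sum_plays] at h1
        have h2 : (plays k T ω : ℝ) ≤ m := by exact_mod_cast hω
        have h3 : (plays k T ω : ℝ) + ∑ i ∈ Finset.univ.erase k, (plays i T ω : ℝ) = T := by
          exact_mod_cast h1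
        simp only [Set.mem_ofPred_eq]
        linarith
    _ = ENNReal.ofReal ((law ν π).real
          {ω | (T : ℝ) - m ≤ ∑ i ∈ Finset.univ.erase k, (plays i T ω : ℝ)}) :=
        (ofReal_measureReal (measure_ne_top _ _)).symm
    _ ≤ _ := by
        refine ENNReal.ofReal_le_ofReal ?_
        rw [le_div_iff₀' hTm]
        exact hM

/-! ### Asymptotic lower bounds on the number of plays -/

/-- In an environment where arm `k` is strictly better than all the others, a consistent algorithm
plays the other arms `o(T ^ a)` times in total. -/
lemma IsConsistent.tendsto_sum_expectedPlays {M : Set (ProbabilityMeasure ℝ)} {π : Policy K}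
    (hπ : IsConsistent π M) {ν : Env K} (hν : ∀ i, ν i ∈ M) {k : Fin K}
    (hk : ∀ i, i ≠ k → mean (ν i) < mean (ν k)) {a : ℝ} (ha : 0 < a) :
    Tendsto (fun T : ℕ => (∑ i ∈ Finset.univ.erase k, expectedPlays ν π i T) / (T : ℝ) ^ a)
      atTop (𝓝 0) := by
  have hs : ∀ i, i ≠ k → ν.IsSuboptimal i := fun i hi =>
    (hk i hi).trans_le (le_ciSup (f := fun i => mean (ν i)) (Set.finite_range _).bddAbove k)
  simp_rw [Finset.sum_div]
  rw [← Finset.sum_const_zero (s := Finset.univ.erase k) (ι := Fin K)]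
  exact tendsto_finsetSum _ fun i hi => hπ ν hν i (hs i (Finset.ne_of_mem_erase hi)) a ha

/-- A consistent algorithm plays a sub-optimal arm `k` at least `c * log T` times with probability
tending to one, if replacing the distribution of arm `k` by some `Q` in the family with
`c * D(ν k, Q) < 1` makes arm `k` the unique best one. -/
lemma tendsto_law_plays_lt {M : Set (ProbabilityMeasure ℝ)} {π : Policy K}
    (hπ : IsConsistent π M) {ν : Env K} (hν : ∀ i, ν i ∈ M) (k : Fin K)
    {Q : ProbabilityMeasure ℝ} (hQ : Q ∈ M) (hm : ν.bestMean < mean Q)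
    (hfin : InformationTheory.klDiv (ν k : Measure ℝ) (Q : Measure ℝ) ≠ ∞) {c : ℝ} (hc : 0 < c)
    (hcD : c * (InformationTheory.klDiv (ν k : Measure ℝ) (Q : Measure ℝ)).toReal < 1) :
    Tendsto (fun T : ℕ => law ν π {ω | (plays k T ω : ℝ) < c * Real.log T}) atTop (𝓝 0) := by
  classical
  set D : ℝ := (InformationTheory.klDiv (ν k : Measure ℝ) (Q : Measure ℝ)).toReal with hD
  have hD0 : 0 ≤ D := ENNReal.toReal_nonneg
  obtain ⟨hac, hint⟩ := InformationTheory.klDiv_ne_top_iff.1 hfin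
  set Y : ℝ → ℝ := llr (ν k : Measure ℝ) (Q : Measure ℝ) with hY
  have mY : Measurable Y := measurable_llr _ _
  have hYD : ∫ x, Y x ∂(ν k : Measure ℝ) ≤ D :=
    (InformationTheory.toReal_klDiv_of_measure_eq hac (by simp)).ge
  -- the environment where `Q` replaces the distribution of arm `k`
  set ν' : Env K := Function.update ν k Q with hν'
  have hk' : ν' k = Q := by simp [hν']
  have hne : ∀ i, i ≠ k → ν i = ν' i := fun i hi => by simp [hν', hi]
  have hM' : ∀ i, ν' i ∈ M := fun i => by
    by_cases hi : i = k
    · subst hi; rwa [hk']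
    · rw [← hne i hi]; exact hν i
  have hbest : ∀ i, i ≠ k → mean (ν' i) < mean (ν' k) := fun i hi => by
    rw [hk', ← hne i hi]
    exact (le_ciSup (f := fun i => mean (ν i)) (Set.finite_range _).bddAbove i).trans_lt hm
  have hden : (ν k : Measure ℝ) ≤
      (ν' k : Measure ℝ).withDensity fun x => ENNReal.ofReal (Real.exp (Y x)) := by
    rw [hk']; exact le_withDensity_exp_llr hac
  -- `ε` leaves room between `b = c * (D + ε)` and `1`
  set ε : ℝ := (1 - c * D) / (2 * c) with hε
  have hε0 : 0 < ε := div_pos (by linarith) (by linarith)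
  set b : ℝ := c * (D + ε) with hb
  have hb1 : b < 1 := by
    have : c * ε = (1 - c * D) / 2 := by rw [hε]; field_simp
    rw [hb, mul_add, this]; linarith
  set S : ℕ → ℝ := fun T => ∑ i ∈ Finset.univ.erase k, expectedPlays ν' π i T with hS
  have hS0 : ∀ T, 0 ≤ S T := fun T =>
    Finset.sum_nonneg fun i _ => integral_nonneg fun ω => Nat.cast_nonneg _
  set m : ℕ → ℕ := fun T => ⌈c * Real.log T⌉₊ with hmdef
  have hlog : Tendsto (fun T : ℕ => Real.log T) atTop atTop :=
    Real.tendsto_log_atTop.comp tendsto_natCast_atTop_atTop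
  have hmtop : Tendsto m atTop atTop :=
    tendsto_nat_ceil_atTop.comp (hlog.const_mul_atTop hc)
  have hmle : ∀ᶠ T : ℕ in atTop, (m T : ℝ) ≤ c * Real.log T + 1 := by
    filter_upwards [eventually_ge_atTop 1] with T hT
    exact (Nat.ceil_lt_add_one (mul_nonneg hc.le (Real.log_natCast_nonneg T))).le
  have hhalf : ∀ᶠ T : ℕ in atTop, (m T : ℝ) ≤ T / 2 := by
    have h1 : ∀ᶠ T : ℕ in atTop, ‖Real.log T‖ ≤ 1 / (4 * c) * ‖(T : ℝ)‖ :=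
      tendsto_natCast_atTop_atTop.eventually
        (Real.isLittleO_log_id_atTop.bound (c := 1 / (4 * c)) (by positivity))
    filter_upwards [hmle, h1, eventually_ge_atTop 4] with T h2 h3 h4
    have h5 : (4 : ℝ) ≤ T := by exact_mod_cast h4
    rw [Real.norm_eq_abs, Real.norm_eq_abs, Nat.abs_cast] at h3
    have h6 := mul_le_mul_of_nonneg_left ((le_abs_self _).trans h3) hc.le
    have h7 : c * (1 / (4 * c) * (T : ℝ)) = T / 4 := by field_simp
    linarith
  set C : ℝ := 2 * Real.exp (D + ε) with hC
  have hlim : Tendsto (fun T : ℕ => ENNReal.ofReal (C * (S T / (T : ℝ) ^ (1 - b)))) atTop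
      (𝓝 0) := by
    have h := (hπ.tendsto_sum_expectedPlays hM' hbest (a := 1 - b) (by linarith)).const_mul C
    rw [mul_zero] at h
    have h' := ENNReal.tendsto_ofReal h
    rwa [ENNReal.ofReal_zero] at h'
  -- the typical log-likelihood ratio: change of measure and consistency
  have hsmall : ∀ᶠ T : ℕ in atTop,
      law ν π {ω | plays k T ω ≤ m T ∧ rewardSum k Y T ω ≤ m T * (D + ε)} ≤
        ENNReal.ofReal (C * (S T / (T : ℝ) ^ (1 - b))) := by
    filter_upwards [hmle, hhalf, eventually_ge_atTop 1] with T h1 h2 h3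
    have hT : (0 : ℝ) < T := by exact_mod_cast h3
    have hmT : m T < T := by
      have : (m T : ℝ) < T := by linarith
      exact_mod_cast this
    calc _ ≤ ENNReal.ofReal (Real.exp (m T * (D + ε))) * law ν' π {ω | plays k T ω ≤ m T} :=
          law_le_exp_mul_law π hne mY hden T (m T) _
      _ ≤ ENNReal.ofReal (Real.exp (m T * (D + ε))) * ENNReal.ofReal (S T / (T - m T)) := by
          gcongr
          exact law_plays_le_le ν' π k hmT
      _ = ENNReal.ofReal (Real.exp (m T * (D + ε)) * (S T / (T - m T))) :=
          (ENNReal.ofReal_mul (Real.exp_pos _).le).symm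
      _ ≤ _ := by
          refine ENNReal.ofReal_le_ofReal ?_
          have e1 : Real.exp (m T * (D + ε)) ≤ Real.exp (D + ε) * (T : ℝ) ^ b := by
            rw [Real.rpow_def_of_pos hT, ← Real.exp_add, Real.exp_le_exp, hb]
            nlinarith [mul_le_mul_of_nonneg_right h1 (by linarith : 0 ≤ D + ε)]
          have e2 : S T / (T - m T) ≤ S T / (T / 2) :=
            div_le_div_of_nonneg_left (hS0 T) (by linarith) (by linarith)
          calc _ ≤ (Real.exp (D + ε) * (T : ℝ) ^ b) * (S T / (T / 2)) :=
                mul_le_mul e1 e2 (div_nonneg (hS0 T) (by linarith)) (by positivity)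
            _ = _ := by
                rw [Real.rpow_sub hT, Real.rpow_one, hC]
                have := (Real.rpow_pos_of_pos hT b).ne'
                field_simp
  refine ENNReal.tendsto_nhds_zero.2 fun δ hδ => ?_
  obtain ⟨δ', hδ'0, hδ'⟩ : ∃ δ' : ℝ, 0 < δ' ∧ ENNReal.ofReal δ' ≤ δ / 2 := by
    obtain ⟨r, hr0, hr⟩ := ENNReal.lt_iff_exists_nnreal_btwn.1 (ENNReal.half_pos hδ.ne')
    exact ⟨r, by exact_mod_cast hr0, by simpa using hr.le⟩
  obtain ⟨m₀, hm₀⟩ := exists_law_rewardSum_gt_le ν π k mY hint hD0 hYD hε0 hδ'0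
  filter_upwards [hsmall, ENNReal.tendsto_nhds_zero.1 hlim (δ / 2) (ENNReal.half_pos hδ.ne'),
    hmtop.eventually_ge_atTop m₀] with T h1 h2 h3
  calc _ ≤ law ν π ({ω | plays k T ω ≤ m T ∧ m T * (D + ε) < rewardSum k Y T ω} ∪
          {ω | plays k T ω ≤ m T ∧ rewardSum k Y T ω ≤ m T * (D + ε)}) := by
        refine measure_mono fun ω hω => ?_
        have h4 : plays k T ω ≤ m T := by
          have : (plays k T ω : ℝ) ≤ m T := (le_of_lt hω).trans (Nat.le_ceil _)
          exact_mod_cast this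
        rcases lt_or_ge (m T * (D + ε)) (rewardSum k Y T ω) with h5 | h5
        exacts [Or.inl ⟨h4, h5⟩, Or.inr ⟨h4, h5⟩]
    _ ≤ δ / 2 + δ / 2 := (measure_union_le _ _).trans
        (add_le_add ((hm₀ _ h3 T).trans hδ') (h1.trans h2))
    _ = δ := ENNReal.add_halves δ

/-- The lower bound in probability, for every constant `c` below `1 / d_inf`. -/
lemma tendsto_law_le_plays_div_log {M : Set (ProbabilityMeasure ℝ)} {π : Policy K}
    (hπ : IsConsistent π M) {ν : Env K} (hν : ∀ i, ν i ∈ M) (k : Fin K) {c : ℝ} (hc : 0 < c)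
    (hcd : ENNReal.ofReal c * dInf (ν k) ν.bestMean M < 1) :
    Tendsto (fun T : ℕ => law ν π {ω | c ≤ (plays k T ω : ℝ) / Real.log T}) atTop (𝓝 1) := by
  have hc' : ENNReal.ofReal c ≠ 0 := by simpa using hc
  have h1 : dInf (ν k) ν.bestMean M < (ENNReal.ofReal c)⁻¹ := by
    rw [← one_div, ENNReal.lt_div_iff_mul_lt (Or.inl hc') (Or.inl ENNReal.ofReal_ne_top), mul_comm]
    exact hcd
  obtain ⟨Q, ⟨hQ, hm⟩, hQd⟩ : ∃ Q : ProbabilityMeasure ℝ, (Q ∈ M ∧ ν.bestMean < mean Q) ∧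
      InformationTheory.klDiv (ν k : Measure ℝ) (Q : Measure ℝ) < (ENNReal.ofReal c)⁻¹ := by
    simpa [dInf, iInf_lt_iff] using h1
  have hfin := hQd.ne_top
  have hcD : c * (InformationTheory.klDiv (ν k : Measure ℝ) (Q : Measure ℝ)).toReal < 1 := by
    have h2 := (ENNReal.toReal_lt_toReal hfin (ENNReal.inv_ne_top.2 hc')).2 hQd
    rw [ENNReal.toReal_inv, ENNReal.toReal_ofReal hc.le] at h2
    calc _ < c * c⁻¹ := mul_lt_mul_of_pos_left h2 hc
      _ = 1 := mul_inv_cancel₀ hc.ne'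
  have h3 := tendsto_law_plays_lt hπ hν k hQ hm hfin hc hcD
  have h4 : Tendsto (fun T : ℕ => 1 - law ν π {ω | (plays k T ω : ℝ) < c * Real.log T}) atTop
      (𝓝 1) := by
    simpa using ENNReal.Tendsto.sub tendsto_const_nhds h3 (Or.inl ENNReal.one_ne_top)
  refine h4.congr' ?_
  filter_upwards [eventually_ge_atTop 2] with T hT
  have hlog : 0 < Real.log T := Real.log_pos (by exact_mod_cast hT)
  have hmeas : MeasurableSet {ω | (plays k T ω : ℝ) < c * Real.log T} :=
    (measurable_from_top.comp (measurable_plays k T) : Measurable fun ω => (plays k T ω : ℝ))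
      measurableSet_Iio
  rw [← prob_compl_eq_one_sub hmeas]
  congr 1
  ext ω
  simp only [Set.mem_compl_iff, Set.mem_ofPred_eq, not_lt, le_div_iff₀ hlog]

/-- The lower bound in expectation, for every constant `c` below `1 / d_inf`. -/
lemma le_liminf_expectedPlays_div_log (π : Policy K) (ν : Env K) (k : Fin K) {c : ℝ} (hc : 0 < c)
    (h : Tendsto (fun T : ℕ => law ν π {ω | c ≤ (plays k T ω : ℝ) / Real.log T}) atTop (𝓝 1)) :
    ENNReal.ofReal c ≤
      liminf (fun T : ℕ => ENNReal.ofReal (expectedPlays ν π k T / Real.log T)) atTop := by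
  have h1 : Tendsto (fun T : ℕ => ENNReal.ofReal c *
      law ν π {ω | c ≤ (plays k T ω : ℝ) / Real.log T}) atTop (𝓝 (ENNReal.ofReal c)) := by
    simpa using ENNReal.Tendsto.const_mul (a := ENNReal.ofReal c) h (Or.inl one_ne_zero)
  rw [← h1.liminf_eq]
  refine liminf_le_liminf ?_
  filter_upwards [eventually_ge_atTop 2] with T hT
  have hlog : 0 < Real.log T := Real.log_pos (by exact_mod_cast hT)
  have hM := mul_meas_ge_le_integral_of_nonneg (μ := law ν π)
    (f := fun ω => (plays k T ω : ℝ) / Real.log T)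
    (ae_of_all _ fun ω => div_nonneg (Nat.cast_nonneg _) hlog.le)
    ((integrable_plays ν π k T).div_const _) c
  rw [integral_div] at hM
  calc _ = ENNReal.ofReal
        (c * (law ν π).real {ω | c ≤ (plays k T ω : ℝ) / Real.log T}) := by
        rw [ENNReal.ofReal_mul hc.le, ofReal_measureReal (measure_ne_top _ _)]
    _ ≤ _ := ENNReal.ofReal_le_ofReal hM

end Bandit

theorem theorem3 {K : ℕ} (M : Set (ProbabilityMeasure ℝ))
    (hM : ∀ P ∈ M, Integrable (fun x : ℝ => x) (P : Measure ℝ))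
    (π : Bandit.Policy K) (hπ : Bandit.IsConsistent π M)
    (ν : Bandit.Env K) (hν : ∀ i, ν i ∈ M)
    (k : Fin K) (hk : ν.IsSuboptimal k) :
    -- lower bound in probability
    (Bandit.dInf (ν k) ν.bestMean M ≠ 0 →
      ∀ η : ℝ, 0 < η → η < 1 →
        Tendsto
          (fun T : ℕ => Bandit.law ν π
            {ω | ENNReal.ofReal (1 - η) / Bandit.dInf (ν k) ν.bestMean M ≤
              ENNReal.ofReal ((Bandit.plays k T ω : ℝ) / Real.log T)})
          atTop (𝓝 1)) ∧
    -- lower bound in probability when the threshold `1 / d_inf` is infinite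
    (Bandit.dInf (ν k) ν.bestMean M = 0 →
      ∀ c : ℝ,
        Tendsto
          (fun T : ℕ => Bandit.law ν π
            {ω | c ≤ (Bandit.plays k T ω : ℝ) / Real.log T})
          atTop (𝓝 1)) ∧
    -- lower bound in expectation, in `[0, ∞]`, where `1 / 0 = ∞` and `1 / ∞ = 0`
    1 / Bandit.dInf (ν k) ν.bestMean M ≤
      liminf (fun T : ℕ => ENNReal.ofReal (Bandit.expectedPlays ν π k T / Real.log T))
        atTop := by
  set d := Bandit.dInf (ν k) ν.bestMean M with hd
  refine ⟨fun hd0 η hη0 hη1 => ?_, fun hd0 c => ?_, ?_⟩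
  · rcases eq_or_ne d ∞ with hdt | hdt
    · simp [hdt]
    have hdr : 0 < d.toReal := ENNReal.toReal_pos hd0 hdt
    have hc : 0 < (1 - η) / d.toReal := div_pos (by linarith) hdr
    have hcd : ENNReal.ofReal ((1 - η) / d.toReal) = ENNReal.ofReal (1 - η) / d := by
      rw [ENNReal.ofReal_div_of_pos hdr, ENNReal.ofReal_toReal hdt]
    have h := Bandit.tendsto_law_le_plays_div_log hπ hν k hc (by
      rw [hcd, ← hd, ENNReal.div_mul_cancel hd0 hdt, ENNReal.ofReal_lt_one]
      linarith)
    refine h.congr fun T => ?_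
    congr 1
    ext ω
    have hnn : 0 ≤ (Bandit.plays k T ω : ℝ) / Real.log T :=
      div_nonneg (Nat.cast_nonneg _) (Real.log_natCast_nonneg T)
    simp only [Set.mem_ofPred_eq, ← hcd, ENNReal.ofReal_le_ofReal_iff hnn]
  · have h := Bandit.tendsto_law_le_plays_div_log hπ hν k (c := max c 1)
      (lt_of_lt_of_le one_pos (le_max_right _ _)) (by rw [← hd, hd0]; simp)
    refine tendsto_of_tendsto_of_tendsto_of_le_of_le h tendsto_const_nhds (fun T => ?_)
      fun T => prob_le_one
    exact measure_mono fun ω hω => (le_max_left c 1).trans hω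
  · refine ENNReal.le_of_forall_pos_nnreal_lt fun r hr0 hr => ?_
    have hc : (0 : ℝ) < r := by exact_mod_cast hr0
    have h := Bandit.le_liminf_expectedPlays_div_log π ν k hc
      (Bandit.tendsto_law_le_plays_div_log hπ hν k hc (by
        rw [← hd, ENNReal.ofReal_coe_nnreal]
        exact ENNReal.mul_lt_of_lt_div hr))
    simpa using h
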